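/- A \emph{tree over a finite nonempty set of qubits} $\{1,\dots,n\}$ is a finite rooted tree in which every vertex $v$ is labeled with a set $S(v)\subseteq\{1,\dots,n\}$, every leaf is labeled with $\alpha|0\rangle+\beta|1\rangle$ ($\alpha,\beta\in\mathbb{C}$), every non-leaf vertex (gate) is labeled with $+$ or $\otimes$, and the outgoing edges of every $+$ gate are labeled with complex numbers, such that: $|S(v)|=1$ if $v$ is a leaf; $S(v)=\{1,\dots,n\}$ if $v$ is the root; $S(w)=S(v)$ if $w$ is a child of a $+$ gate $v$; and if $v$ is a $\otimes$ gate, then the sets $S(w)$ of its children $w$ are pairwise disjoint and form a partition of $S(v)$. Fan-in is not bounded. Each vertex $v$ represents a vector on the qubits in $S(v)$: a leaf its label, a $+$ gate the linear combination of the vectors of its children with the edge labels as coefficients, a $\otimes$ gate the tensor product of the vectors of its children. The tree is a \emph{quantum state tree} if every vertex represents a vector of norm $1$; it represents $|\psi\rangle$ if its root does. It is \emph{manifestly orthogonal} if for every $+$ gate, any two distinct children representing $|\psi_1\rangle,|\psi_2\rangle$, and every basis state $|x\rangle$, either $\langle\psi_1|x\rangle=0$ or $\langle\psi_2|x\rangle=0$.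 The \emph{size} of a tree is its number of leaves, and its \emph{depth} is the largest number of edges on a path from the root to a leaf. For a normalized $|\psi\rangle\in(\mathbb{C}^2)^{\otimes n}$, let $\operatorname{TS}(|\psi\rangle)$ be the minimum size of a quantum state tree representing $|\psi\rangle$, and $\operatorname{MOTS}(|\psi\rangle)$ the minimum size of a manifestly orthogonal one. \textbf{Theorem.} For every $\varepsilon>0$ there is a constant $C$ (depending only on $\varepsilon$) such that for every $n\ge 1$ and every normalized state $|\psi\rangle\in(\mathbb{C}^2)^{\otimes n}$: (i) there is a quantum state tree representing $|\psi\rangle$ of size at most $C\,\operatorname{TS}(|\psi\rangle)^{1+\varepsilon}$ and depth at most $C\log\operatorname{TS}(|\psi\rangle)$; (ii) there is a manifestly orthogonal quantum state tree representing $|\psi\rangle$ of size at most $C\,\operatorname{MOTS}(|\psi\rangle)^{1+\varepsilon}$ and depth at most $C\log\operatorname{MOTS}(|\psi\rangle)$. -/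

import Mathlib

/-- The pure-state space of the qubits in `S`, i.e. `H₂^{⊗ S}`: the complex Hilbert space with
orthonormal basis `|y⟩`, `y ∈ {0,1}^S`. The `y`-th coordinate of a vector is its amplitude
on `|y⟩`. -/
abbrev QubitSpace {n : ℕ} (S : Finset (Fin n)) : Type :=
  EuclideanSpace ℂ (S → Fin 2)

/-- Trees over `n` qubits; the index `S` is the label `S(v)` of the root vertex `v`.

* a leaf on qubit `i` carries the label `α|0⟩ + β|1⟩`, and its set is `{i}`;
* a `+` gate has `k ≥ 1` children with the same set as the gate itself, and its `j`-th outgoing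
  edge is labeled with the complex number `c j`;
* a `⊗` gate has `k ≥ 1` children, whose sets are pairwise disjoint and partition the set of
  the gate. -/
inductive QTree (n : ℕ) : Finset (Fin n) → Type
  | leaf {S : Finset (Fin n)} (i : Fin n) (hS : S = {i}) (α β : ℂ) : QTree n S
  | plus {S : Finset (Fin n)} (k : ℕ) (hk : 0 < k) (c : Fin k → ℂ)
      (t : Fin k → QTree n S) : QTree n S
  | tensor {S : Finset (Fin n)} (k : ℕ) (hk : 0 < k) (A : Fin k → Finset (Fin n))
      (hdisj : ∀ j l, j ≠ l → Disjoint (A j) (A l))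
      (hcover : Finset.univ.biUnion A = S)
      (t : ∀ j, QTree n (A j)) : QTree n S

namespace QTree

theorem mem_of_cover {n k : ℕ} {A : Fin k → Finset (Fin n)} {S : Finset (Fin n)}
    (h : Finset.univ.biUnion A = S) (j : Fin k) {i : Fin n} (hi : i ∈ A j) : i ∈ S :=
  h ▸ Finset.mem_biUnion.2 ⟨j, Finset.mem_univ j, hi⟩

theorem mem_of_singleton {n : ℕ} {S : Finset (Fin n)} {i : Fin n} (h : S = {i}) : i ∈ S :=
  h ▸ Finset.mem_singleton_self i

/-- The vector represented by a tree: a leaf represents its label, a `+` gate the linear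
combination of its children with the edge labels as coefficients, and a `⊗` gate the tensor
product of its children, whose amplitude on `|y⟩` is the product of the amplitudes of the
children on the restrictions of `y`. -/
noncomputable def state {n : ℕ} : {S : Finset (Fin n)} → QTree n S → QubitSpace S
  | _, leaf i hS α β => WithLp.toLp 2 fun y => ![α, β] (y ⟨i, mem_of_singleton hS⟩)
  | _, plus _ _ c t => ∑ j, c j • (t j).state
  | _, tensor _ _ _ _ hcover t =>
      WithLp.toLp 2 fun y => ∏ j, (t j).state fun i => y ⟨i.1, mem_of_cover hcover j i.2⟩

/-- Every vertex of the tree represents a normalized state. -/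
def IsNormalized {n : ℕ} : {S : Finset (Fin n)} → QTree n S → Prop
  | _, leaf i hS α β => ‖(leaf i hS α β).state‖ = 1
  | _, plus k hk c t => ‖(plus k hk c t).state‖ = 1 ∧ ∀ j, (t j).IsNormalized
  | _, tensor k hk A hdisj hcover t =>
      ‖(tensor k hk A hdisj hcover t).state‖ = 1 ∧ ∀ j, (t j).IsNormalized

/-- At every `+` gate, any two distinct children have disjoint supports: every basis state has
amplitude zero in at least one of the two. -/
def IsManifestlyOrthogonal {n : ℕ} : {S : Finset (Fin n)} → QTree n S → Prop
  | _, leaf _ _ _ _ => True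
  | _, plus _ _ _ t =>
      (∀ j l, j ≠ l → ∀ y, (t j).state y = 0 ∨ (t l).state y = 0) ∧
        ∀ j, (t j).IsManifestlyOrthogonal
  | _, tensor _ _ _ _ _ t => ∀ j, (t j).IsManifestlyOrthogonal

/-- The size of a tree: its number of leaf vertices. -/
def size {n : ℕ} : {S : Finset (Fin n)} → QTree n S → ℕ
  | _, leaf _ _ _ _ => 1
  | _, plus _ _ _ t => ∑ j, (t j).size
  | _, tensor _ _ _ _ _ t => ∑ j, (t j).size

/-- The depth of a tree: the largest number of edges on a path from the root to a leaf. -/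
def depth {n : ℕ} : {S : Finset (Fin n)} → QTree n S → ℕ
  | _, leaf _ _ _ _ => 0
  | _, plus _ _ _ t => (Finset.univ.sup fun j => (t j).depth) + 1
  | _, tensor _ _ _ _ _ t => (Finset.univ.sup fun j => (t j).depth) + 1

/-- `T` is a quantum state tree representing the `n`-qubit state `ψ`: the root is labeled with
the set of all qubits, every vertex is normalized, and the root represents `ψ`. -/
def Represents {n : ℕ} (T : QTree n Finset.univ) (ψ : EuclideanSpace ℂ (Fin n → Fin 2)) : Prop :=
  T.IsNormalized ∧ ∀ x : Fin n → Fin 2, (T.state fun i => x i.1) = ψ x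

end QTree

/-- The tree size `TS(ψ)`: the minimum size of a quantum state tree representing `ψ`. -/
noncomputable def treeSize {n : ℕ} (ψ : EuclideanSpace ℂ (Fin n → Fin 2)) : ℕ :=
  sInf {s | ∃ T : QTree n Finset.univ, T.Represents ψ ∧ T.size = s}

/-- The manifestly orthogonal tree size `MOTS(ψ)`: the minimum size of a manifestly orthogonal
quantum state tree representing `ψ`. -/
noncomputable def manifestlyOrthogonalTreeSize {n : ℕ}
    (ψ : EuclideanSpace ℂ (Fin n → Fin 2)) : ℕ :=
  sInf {s | ∃ T : QTree n Finset.univ,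
    T.Represents ψ ∧ T.IsManifestlyOrthogonal ∧ T.size = s}

/-! This is Brent-style depth reduction for formulas, carried out without normalization. Pushing
edge weights into leaves turns a state tree into a binary formula of the same size (`of_qTree`). In
a formula `f` of size `s`, walk down from the root as long as some child has size above `(1 - δ) *
s`. The last gate `J` reached has inputs of sizes `a`, `b` at most `(1 - δ) * s`, and `f = H * J +
G`: `H` multiplies the factors passed on the way, `G` gathers the other contributions, and both are
built from the `c < δ * s` leaves off the path (`exists_splits`).

Rebuilding these four pieces recursively costs three levels per shrinking by `1 - δ`, hence
logarithmic depth. Only the `c` leaves are used twice, and `2 * c ^ (1 + ε) ≤ c * s ^ ε` once `2 * δ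
^ ε ≤ 1`, so the size bound `s ^ (1 + ε)` survives (`within_of_two_mul_rpow_le`).

The splitting preserves disjointness of supports, so the flag `o` treats both claims at once.
Finally zero summands are dropped and vertices rescaled (`exists_qTree`). -/

/-! ### Unnormalized binary formulas -/

/-- `BinaryFormula o S s d f`: the function `f` of the bits is computed by a binary tree with set `S`,
size `s` and depth `d`, whose gates are unweighted sums and products; if `o` holds, the two
children of every sum have disjoint supports. No normalization is imposed. -/
inductive BinaryFormula {n : ℕ} (o : Prop) :
    Finset (Fin n) → ℕ → ℕ → ((Fin n → Fin 2) → ℂ) → Prop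
  | leaf (i : Fin n) (α β : ℂ) : BinaryFormula o {i} 1 0 (fun x => ![α, β] (x i))
  | add {S : Finset (Fin n)} {s s' d d' : ℕ} {f g : (Fin n → Fin 2) → ℂ}
      (hf : BinaryFormula o S s d f) (hg : BinaryFormula o S s' d' g)
      (h : o → ∀ x, f x = 0 ∨ g x = 0) :
      BinaryFormula o S (s + s') (max d d' + 1) (fun x => f x + g x)
  | mul {S S' : Finset (Fin n)} {s s' d d' : ℕ} {f g : (Fin n → Fin 2) → ℂ}
      (hf : BinaryFormula o S s d f) (hg : BinaryFormula o S' s' d' g) (h : Disjoint S S') :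
      BinaryFormula o (S ∪ S') (s + s') (max d d' + 1) (fun x => f x * g x)

namespace BinaryFormula

variable {n : ℕ} {o : Prop} {S S' : Finset (Fin n)} {s s' d d' : ℕ}
  {f g : (Fin n → Fin 2) → ℂ}

theorem size_pos (hf : BinaryFormula o S s d f) : 0 < s := by
  induction hf <;> omega

/-- There are no unary gates. This starts the depth induction, where `log 1 = 0` leaves no room for
any level. -/
theorem depth_eq_zero (hf : BinaryFormula o S s d f) (hs : s = 1) : d = 0 := by
  cases hf with
  | leaf => rfl
  | add hf hg => have := hf.size_pos; have := hg.size_pos; omega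
  | mul hf hg => have := hf.size_pos; have := hg.size_pos; omega

/-- A scalar distributes over sums and is absorbed by one factor of each product, so it ends up in
leaf labels and costs neither size nor depth. -/
theorem const_mul (c : ℂ) (hf : BinaryFormula o S s d f) :
    BinaryFormula o S s d (fun x => c * f x) := by
  induction hf with
  | leaf i α β =>
    have key : ∀ b : Fin 2, c * ![α, β] b = ![c * α, c * β] b := by
      intro b
      fin_cases b <;> simp
    simp only [key]
    exact leaf i (c * α) (c * β)
  | add _ _ h ihf ihg =>
    simp only [mul_add]
    exact ihf.add ihg fun ho x => (h ho x).imp (by simp +contextual) (by simp +contextual)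
  | mul _ hg h ihf _ =>
    simp only [← mul_assoc]
    exact ihf.mul hg h

theorem sum {ι : Type*} {I : Finset ι} (hI : I.Nonempty) (size : ι → ℕ)
    (F : ι → (Fin n → Fin 2) → ℂ) (hF : ∀ i ∈ I, ∃ d, BinaryFormula o S (size i) d (F i))
    (h : o → ∀ i ∈ I, ∀ j ∈ I, i ≠ j → ∀ x, F i x = 0 ∨ F j x = 0) :
    ∃ d, BinaryFormula o S (∑ i ∈ I, size i) d (fun x => ∑ i ∈ I, F i x) := by
  induction hI using Finset.Nonempty.cons_induction with
  | singleton a => simpa using hF a (by simp)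
  | cons a I ha hI ih =>
    obtain ⟨d₁, h₁⟩ := hF a (by simp)
    obtain ⟨d₂, h₂⟩ := ih (fun i hi => hF i (by simp [hi]))
      (fun ho i hi j hj => h ho i (by simp [hi]) j (by simp [hj]))
    simp only [Finset.sum_cons]
    refine ⟨_, h₁.add h₂ fun ho x => ?_⟩
    by_cases hx : F a x = 0
    · exact Or.inl hx
    · refine Or.inr (Finset.sum_eq_zero fun i hi => ?_)
      exact (h ho a (by simp) i (by simp [hi]) (fun e => ha (e ▸ hi)) x).resolve_left hx

theorem prod {ι : Type*} {I : Finset ι} (hI : I.Nonempty) (size : ι → ℕ)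
    (A : ι → Finset (Fin n)) (hA : ∀ i j, i ≠ j → Disjoint (A i) (A j))
    (F : ι → (Fin n → Fin 2) → ℂ) (hF : ∀ i ∈ I, ∃ d, BinaryFormula o (A i) (size i) d (F i)) :
    ∃ d, BinaryFormula o (I.biUnion A) (∑ i ∈ I, size i) d (fun x => ∏ i ∈ I, F i x) := by
  classical
  induction hI using Finset.Nonempty.cons_induction with
  | singleton a => simpa using hF a (by simp)
  | cons a I ha hI ih =>
    obtain ⟨d₁, h₁⟩ := hF a (by simp)
    obtain ⟨d₂, h₂⟩ := ih (fun i hi => hF i (by simp [hi]))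
    have hU : (Finset.cons a I ha).biUnion A = A a ∪ I.biUnion A := by
      rw [Finset.cons_eq_insert, Finset.biUnion_insert]
    rw [hU, Finset.sum_cons]
    simp only [Finset.prod_cons]
    refine ⟨_, h₁.mul h₂ ?_⟩
    rw [Finset.disjoint_biUnion_right]
    exact fun i hi => hA a i fun e => ha (e ▸ hi)

/-- Every function of `n ≥ 1` bits has a formula, a sum over basis states. -/
theorem exists_of_pos (hn : 1 ≤ n) (f : (Fin n → Fin 2) → ℂ) :
    ∃ s d, BinaryFormula o Finset.univ s d f := by
  classical
  have : Nonempty (Fin n) := ⟨⟨0, hn⟩⟩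
  have key : ∀ y : Fin n → Fin 2, ∀ x : Fin n → Fin 2,
      ∏ i, (![if y i = 0 then 1 else 0, if y i = 0 then 0 else 1] : Fin 2 → ℂ) (x i) =
        if y = x then 1 else 0 := by
    intro y x
    have : ∀ i, (![if y i = 0 then 1 else 0, if y i = 0 then 0 else 1] : Fin 2 → ℂ) (x i) =
        if y i = x i then 1 else 0 := by
      intro i
      generalize y i = a
      generalize x i = b
      fin_cases a <;> fin_cases b <;> simp
    simp only [this, Finset.prod_ite_zero, Finset.prod_const_one, funext_iff, Finset.mem_univ,
      true_implies]
  have hprod : ∀ y : Fin n → Fin 2, ∃ d,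
      BinaryFormula o Finset.univ n d (fun x => f y * if y = x then 1 else 0) := by
    intro y
    obtain ⟨d, hd⟩ := prod (o := o) Finset.univ_nonempty (fun _ : Fin n => 1) (fun i => {i})
      (fun i j hij => by simpa using hij) _
      (fun i _ => ⟨0, leaf i (if y i = 0 then 1 else 0) (if y i = 0 then 0 else 1)⟩)
    simp only [key] at hd
    refine ⟨d, ?_⟩
    convert hd.const_mul (f y) using 1
    · ext i; simp
    · simp
  obtain ⟨d, hd⟩ := sum Finset.univ_nonempty (fun _ => n) _ (fun y _ => hprod y)
    (fun _ y _ z _ hyz x => by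
      by_cases hy : y = x
      · right
        rw [if_neg (fun hz => hyz (hy.trans hz.symm)), mul_zero]
      · left
        rw [if_neg hy, mul_zero])
  exact ⟨_, d, by simpa using hd⟩

theorem of_qTree {S : Finset (Fin n)} (T : QTree n S) (hT : o → T.IsManifestlyOrthogonal) :
    ∃ d, BinaryFormula o S T.size d (fun x => T.state fun i => x i.1) := by
  induction T with
  | leaf i hS α β =>
    subst hS
    exact ⟨0, by simpa [QTree.state, QTree.size] using leaf i α β⟩
  | plus k hk c t ih =>
    have : Nonempty (Fin k) := ⟨⟨0, hk⟩⟩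
    simp only [QTree.IsManifestlyOrthogonal] at hT
    simp only [QTree.state, QTree.size, WithLp.ofLp_sum, WithLp.ofLp_smul, Finset.sum_apply,
      Pi.smul_apply, smul_eq_mul]
    refine sum Finset.univ_nonempty _ _ (fun j _ => ?_) fun ho j _ l _ hjl x => ?_
    · obtain ⟨d, hd⟩ := ih j fun ho => (hT ho).2 j
      exact ⟨d, hd.const_mul _⟩
    · exact ((hT ho).1 j l hjl fun i => x i.1).imp (fun h => by rw [h, mul_zero])
        (fun h => by rw [h, mul_zero])
  | tensor k hk A hdisj hcover t ih =>
    have : Nonempty (Fin k) := ⟨⟨0, hk⟩⟩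
    subst hcover
    simp only [QTree.IsManifestlyOrthogonal] at hT
    simp only [QTree.state, QTree.size]
    exact prod Finset.univ_nonempty _ A hdisj _ fun j _ => ih j fun ho => hT ho j

/-! ### Splitting a formula at a heavy gate -/

/-- A formula of size at most `s`, or the constant `1` with empty set. -/
def OrOne (o : Prop) (S : Finset (Fin n)) (s : ℕ) (f : (Fin n → Fin 2) → ℂ) : Prop :=
  (S = ∅ ∧ f = fun _ => 1) ∨ ∃ s' ≤ s, ∃ d, BinaryFormula o S s' d f

/-- A formula of size at most `s`, or the constant `0`. -/
def OrZero (o : Prop) (S : Finset (Fin n)) (s : ℕ) (f : (Fin n → Fin 2) → ℂ) : Prop :=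
  (f = fun _ => 0) ∨ ∃ s' ≤ s, ∃ d, BinaryFormula o S s' d f

/-- A single gate applied to formulas of sizes `a` and `b`. -/
def Gate (o : Prop) (S : Finset (Fin n)) (a b : ℕ) (f : (Fin n → Fin 2) → ℂ) : Prop :=
  (∃ A B d d', BinaryFormula o S a d A ∧ BinaryFormula o S b d' B ∧
    (o → ∀ x, A x = 0 ∨ B x = 0) ∧ f = fun x => A x + B x) ∨
  ∃ U V A B d d', BinaryFormula o U a d A ∧ BinaryFormula o V b d' B ∧ Disjoint U V ∧
    S = U ∪ V ∧ f = fun x => A x * B x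

/-- `f = H * J + G` where `J` is a gate with inputs of sizes `a`, `b` and `H`, `G` are formulas of
size at most `c`. -/
def Splits (o : Prop) (S : Finset (Fin n)) (a b c : ℕ) (f : (Fin n → Fin 2) → ℂ) : Prop :=
  ∃ U V H J G, Gate o U a b J ∧ OrOne o V c H ∧ OrZero o S c G ∧ Disjoint V U ∧ S = V ∪ U ∧
    (f = fun x => H x * J x + G x) ∧ (o → ∀ x, H x * J x = 0 ∨ G x = 0)

theorem OrOne.mul_left (hg : BinaryFormula o S' s' d' g) (h : OrOne o S s f)
    (hS : Disjoint S' S) : OrOne o (S' ∪ S) (s + s') (fun x => g x * f x) := by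
  right
  rcases h with ⟨rfl, rfl⟩ | ⟨t, ht, d, hf⟩
  · exact ⟨s', by omega, d', by simpa using hg⟩
  · exact ⟨s' + t, by omega, _, hg.mul hf hS⟩

theorem OrOne.mono (h : OrOne o S s f) (hs : s ≤ s') : OrOne o S s' f :=
  h.imp id fun ⟨t, ht, d, hf⟩ => ⟨t, ht.trans hs, d, hf⟩

theorem OrZero.mul_left (hg : BinaryFormula o S' s' d' g) (h : OrZero o S s f)
    (hS : Disjoint S' S) : OrZero o (S' ∪ S) (s + s') (fun x => g x * f x) := by
  rcases h with rfl | ⟨t, ht, d, hf⟩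
  · exact Or.inl (by simp)
  · exact Or.inr ⟨s' + t, by omega, _, hg.mul hf hS⟩

theorem OrZero.add_left (hg : BinaryFormula o S s' d' g) (h : OrZero o S s f)
    (hd : o → ∀ x, g x = 0 ∨ f x = 0) : OrZero o S (s + s') (fun x => g x + f x) := by
  right
  rcases h with rfl | ⟨t, ht, d, hf⟩
  · exact ⟨s', by omega, d', by simpa using hg⟩
  · exact ⟨s' + t, by omega, _, hg.add hf hd⟩

theorem Gate.splits {a b : ℕ} (h : Gate o S a b f) : Splits o S a b 0 f :=
  -- Nothing has been passed yet. Formulas have positive size, so at `c = 0` only the constants are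
  -- available for `H` and `G`.
  ⟨S, ∅, fun _ => 1, f, fun _ => 0, h, Or.inl ⟨rfl, rfl⟩, Or.inl rfl, by simp, by simp, by simp,
    by simp⟩

theorem Splits.add_left {a b c : ℕ} (hg : BinaryFormula o S s' d' g) (h : Splits o S a b c f)
    (hd : o → ∀ x, g x = 0 ∨ f x = 0) : Splits o S a b (c + s') (fun x => g x + f x) := by
  obtain ⟨U, V, H, J, G, hJ, hH, hG, hVU, hS, rfl, hdisj⟩ := h
  -- Since `H * J` and `G` have disjoint supports, their sum vanishes only where both do.
  have hd' : o → ∀ x, g x = 0 ∨ (H x * J x = 0 ∧ G x = 0) := by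
    intro ho x
    rcases hd ho x with h | h
    · exact Or.inl h
    · rcases hdisj ho x with h' | h' <;> simp only [h', zero_add, add_zero] at h <;>
        exact Or.inr ⟨‹_›, ‹_›⟩
  refine ⟨U, V, H, J, _, hJ, hH.mono (by omega), hG.add_left hg ?_, hVU, hS, ?_, ?_⟩
  · exact fun ho x => (hd' ho x).imp id And.right
  · funext x; ring
  · intro ho x
    rcases hd' ho x with h | h
    · simpa [h] using hdisj ho x
    · exact Or.inl h.1

/-- A factor passed on the way distributes over `H * J + G`, so its leaves enter both `H` and `G`.
This is the only source of duplication. -/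
theorem Splits.mul_left {a b c : ℕ} (hg : BinaryFormula o S' s' d' g) (h : Splits o S a b c f)
    (hd : Disjoint S' S) : Splits o (S' ∪ S) a b (c + s') (fun x => g x * f x) := by
  obtain ⟨U, V, H, J, G, hJ, hH, hG, hVU, rfl, rfl, hdisj⟩ := h
  rw [Finset.disjoint_union_right] at hd
  refine ⟨U, S' ∪ V, _, J, _, hJ, hH.mul_left hg hd.1, hG.mul_left hg ?_, ?_, ?_, ?_, ?_⟩
  · exact Finset.disjoint_union_right.2 hd
  · exact Finset.disjoint_union_left.2 ⟨hd.2, hVU⟩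
  · rw [Finset.union_assoc]
  · funext x; ring
  · intro ho x
    rcases hdisj ho x with h | h
    · left; rw [mul_assoc, h, mul_zero]
    · right; rw [h, mul_zero]

/-- Descend from the root along the children of size more than `t` and split at the last one. -/
theorem exists_splits {t : ℝ} (ht : 1 ≤ t) (hf : BinaryFormula o S s d f) (hs : t < s) :
    ∃ a b c : ℕ, a + b + c = s ∧ (a : ℝ) ≤ t ∧ (b : ℝ) ≤ t ∧ t < (a + b : ℕ) ∧
      Splits o S a b c f := by
  induction hf with
  -- Because `1 ≤ t`, a leaf is never heavy, so the descent ends at a gate.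
  | leaf i α β => norm_num at hs; linarith
  | @add S s s' d d' f g hf hg h ihf ihg =>
    by_cases h₁ : t < s
    · obtain ⟨a, b, c, habc, ha, hb, hab, H⟩ := ihf h₁
      refine ⟨a, b, c + s', by omega, ha, hb, hab, ?_⟩
      simp only [add_comm (f _)]
      exact H.add_left hg fun ho x => (h ho x).symm
    by_cases h₂ : t < s'
    · obtain ⟨a, b, c, habc, ha, hb, hab, H⟩ := ihg h₂
      exact ⟨a, b, c + s, by omega, ha, hb, hab, H.add_left hf h⟩
    exact ⟨s, s', 0, rfl, not_lt.1 h₁, not_lt.1 h₂, hs,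
      Gate.splits (Or.inl ⟨f, g, d, d', hf, hg, h, rfl⟩)⟩
  | @mul S S' s s' d d' f g hf hg h ihf ihg =>
    by_cases h₁ : t < s
    · obtain ⟨a, b, c, habc, ha, hb, hab, H⟩ := ihf h₁
      refine ⟨a, b, c + s', by omega, ha, hb, hab, ?_⟩
      simp only [mul_comm (f _), Finset.union_comm S]
      exact H.mul_left hg h.symm
    by_cases h₂ : t < s'
    · obtain ⟨a, b, c, habc, ha, hb, hab, H⟩ := ihg h₂
      exact ⟨a, b, c + s, by omega, ha, hb, hab, H.mul_left hf h⟩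
    exact ⟨s, s', 0, rfl, not_lt.1 h₁, not_lt.1 h₂, hs,
      Gate.splits (Or.inr ⟨S, S', f, g, d, d', hf, hg, h, rfl, rfl⟩)⟩

/-! ### Recursive depth reduction -/

/-- `f` has a formula of size at most `x` and depth at most `y`. -/
def Within (o : Prop) (S : Finset (Fin n)) (x y : ℝ) (f : (Fin n → Fin 2) → ℂ) : Prop :=
  ∃ s d : ℕ, BinaryFormula o S s d f ∧ (s : ℝ) ≤ x ∧ (d : ℝ) ≤ y

theorem Within.mono {x y x' y' : ℝ} (h : Within o S x y f) (hx : x ≤ x') (hy : y ≤ y') :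
    Within o S x' y' f := by
  obtain ⟨s, d, hf, h₁, h₂⟩ := h
  exact ⟨s, d, hf, h₁.trans hx, h₂.trans hy⟩

theorem Within.add {x x' y : ℝ} (hf : Within o S x y f) (hg : Within o S x' y g)
    (h : o → ∀ x, f x = 0 ∨ g x = 0) : Within o S (x + x') (y + 1) (fun z => f z + g z) := by
  obtain ⟨s, d, hf, h₁, h₂⟩ := hf
  obtain ⟨s', d', hg, h₁', h₂'⟩ := hg
  refine ⟨_, _, hf.add hg h, ?_, ?_⟩
  · push_cast; linarith
  · push_cast; linarith [max_le h₂ h₂']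

theorem Within.mul {x x' y : ℝ} (hf : Within o S x y f) (hg : Within o S' x' y g)
    (h : Disjoint S S') : Within o (S ∪ S') (x + x') (y + 1) (fun z => f z * g z) := by
  obtain ⟨s, d, hf, h₁, h₂⟩ := hf
  obtain ⟨s', d', hg, h₁', h₂'⟩ := hg
  refine ⟨_, _, hf.mul hg h, ?_, ?_⟩
  · push_cast; linarith
  · push_cast; linarith [max_le h₂ h₂']

/-- The three extra levels are the gate `J`, the product with `H` and the sum with `G`; the factor
`2` counts `H` and `G` separately. -/
theorem Splits.within {a b c : ℕ} {p : ℕ → ℝ} {y : ℝ} (h : Splits o S a b c f)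
    (hp : 0 ≤ p c)
    (ha : ∀ (U : Finset (Fin n)) d g, BinaryFormula o U a d g → Within o U (p a) y g)
    (hb : ∀ (U : Finset (Fin n)) d g, BinaryFormula o U b d g → Within o U (p b) y g)
    (hc : ∀ (U : Finset (Fin n)), ∀ s' ≤ c, ∀ d g, BinaryFormula o U s' d g → Within o U (p c) y g) :
    Within o S (p a + p b + 2 * p c) (y + 3) f := by
  obtain ⟨U, V, H, J, G, hJ, hH, hG, hVU, rfl, rfl, hdisj⟩ := h
  have hJ' : Within o U (p a + p b) (y + 1) J := by
    rcases hJ with ⟨A, B, d, d', hA, hB, hAB, rfl⟩ | ⟨W, W', A, B, d, d', hA, hB, hAB, rfl, rfl⟩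
    · exact (ha _ _ _ hA).add (hb _ _ _ hB) hAB
    · exact (ha _ _ _ hA).mul (hb _ _ _ hB) hAB
  have hHJ : Within o (V ∪ U) (p a + p b + p c) (y + 2) (fun x => H x * J x) := by
    rcases hH with ⟨rfl, rfl⟩ | ⟨s', hs', d, hH⟩
    · simpa using hJ'.mono (by linarith) (by linarith)
    · exact (((hc _ s' hs' _ _ hH).mono le_rfl (by linarith)).mul hJ' hVU).mono
        (by linarith) (by linarith)
  rcases hG with rfl | ⟨s', hs', d, hG⟩
  · simpa using hHJ.mono (by linarith) (by linarith)
  · exact (hHJ.add ((hc _ s' hs' _ _ hG).mono le_rfl (by linarith)) hdisj).mono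
      (by linarith) (by linarith)

theorem within_of_two_mul_rpow_le {ε δ : ℝ} (hε : 0 < ε) (hδ : 0 < δ) (hδ' : δ ≤ 1 / 2)
    (h : 2 * δ ^ ε ≤ 1) (hf : BinaryFormula o S s d f) :
    Within o S ((s : ℝ) ^ (1 + ε)) (3 / -Real.log (1 - δ) * Real.log s) f := by
  have hlog : 0 < -Real.log (1 - δ) := by
    have := Real.log_neg (x := 1 - δ) (by linarith) (by linarith)
    linarith
  set K := 3 / -Real.log (1 - δ)
  have hK0 : 0 < K := by positivity
  induction s using Nat.strong_induction_on generalizing S d f with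
  | _ s ih =>
  have hs0 := hf.size_pos
  obtain rfl | hs2 : s = 1 ∨ 2 ≤ s := by omega
  · exact ⟨1, d, hf, by simp, by simp [hf.depth_eq_zero rfl]⟩
  have hs2' : (2 : ℝ) ≤ s := by exact_mod_cast hs2
  obtain ⟨a, b, c, rfl, ha, hb, hab, hsplit⟩ :=
    hf.exists_splits (t := (1 - δ) * s) (by nlinarith) (by nlinarith)
  set s := a + b + c with hs
  have hsR : (s : ℝ) = a + b + c := by rw [hs]; push_cast; ring
  have hcδ : (c : ℝ) ≤ δ * s := by push_cast at hab; nlinarith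
  -- As `δ ≤ 1 / 2`, one depth bound serves all four pieces; the sharper `hcδ` is needed only for
  -- size.
  have hc' : (c : ℝ) ≤ (1 - δ) * s := by nlinarith
  have small : ∀ m : ℕ, (m : ℝ) ≤ (1 - δ) * s → ∀ U : Finset (Fin n), ∀ s' ≤ m, ∀ d g,
      BinaryFormula o U s' d g →
        Within o U ((m : ℝ) ^ (1 + ε)) (K * Real.log ((1 - δ) * s)) g := by
    intro m hm U s' hs' d g hg
    have h0 := hg.size_pos
    have hs'R : (s' : ℝ) ≤ m := by exact_mod_cast hs'
    have hlt : s' < s := by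
      have : (s' : ℝ) < s := by nlinarith
      exact_mod_cast this
    have h0R : (0 : ℝ) < s' := by exact_mod_cast h0
    refine (ih s' hlt hg).mono (by gcongr) ?_
    gcongr
    linarith
  -- `K` is chosen so that shrinking by `1 - δ` pays for exactly three levels.
  have hy : K * Real.log ((1 - δ) * s) + 3 = K * Real.log s := by
    have h3 : K * -Real.log (1 - δ) = 3 := div_mul_cancel₀ _ hlog.ne'
    rw [Real.log_mul (by linarith) (by linarith)]
    linarith
  have main := hsplit.within (p := fun m : ℕ => (m : ℝ) ^ (1 + ε)) (by positivity)
    (fun U d g => small a ha U a le_rfl d g) (fun U d g => small b hb U b le_rfl d g)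
    (small c hc')
  refine main.mono ?_ hy.le
  have hpow : ∀ m : ℕ, (m : ℝ) ^ (1 + ε) = m * (m : ℝ) ^ ε := fun m => by
    rw [Real.rpow_add_of_nonneg (by positivity) (by positivity) hε.le, Real.rpow_one]
  have hle : ∀ m : ℕ, (m : ℝ) ≤ s → (m : ℝ) ^ (1 + ε) ≤ m * (s : ℝ) ^ ε := fun m hm => by
    rw [hpow]; gcongr
  have hc2 : 2 * (c : ℝ) ^ (1 + ε) ≤ c * (s : ℝ) ^ ε := by
    have h₁ : (c : ℝ) ^ ε ≤ δ ^ ε * (s : ℝ) ^ ε := by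
      rw [← Real.mul_rpow hδ.le (by positivity)]; gcongr
    have h₂ : 2 * (c : ℝ) ^ ε ≤ (s : ℝ) ^ ε := by
      nlinarith [Real.rpow_nonneg (Nat.cast_nonneg (α := ℝ) s) ε]
    rw [hpow]
    nlinarith [Nat.cast_nonneg (α := ℝ) c]
  have h₁ := hle a (by nlinarith)
  have h₂ := hle b (by nlinarith)
  calc (a : ℝ) ^ (1 + ε) + (b : ℝ) ^ (1 + ε) + 2 * (c : ℝ) ^ (1 + ε)
      ≤ a * (s : ℝ) ^ ε + b * (s : ℝ) ^ ε + c * (s : ℝ) ^ ε := by linarith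
    _ = (s : ℝ) ^ (1 + ε) := by rw [hpow s]; nth_rewrite 4 [hsR]; ring

/-- Depth reduction for formulas. -/
theorem exists_within {ε : ℝ} (hε : 0 < ε) : ∃ K : ℝ, ∀ (n : ℕ) (o : Prop) (S : Finset (Fin n))
    (s d : ℕ) (f : (Fin n → Fin 2) → ℂ), BinaryFormula o S s d f →
      Within o S ((s : ℝ) ^ (1 + ε)) (K * Real.log s) f := by
  refine ⟨3 / -Real.log (1 - min (1 / 2) ((1 / 2) ^ (1 / ε))), fun n o S s d f hf =>
    hf.within_of_two_mul_rpow_le hε (by positivity) (min_le_left _ _) ?_⟩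
  have : (min (1 / 2) ((1 / 2) ^ (1 / ε)) : ℝ) ^ ε ≤ ((1 / 2) ^ (1 / ε)) ^ ε := by
    gcongr
    exact min_le_right _ _
  rw [← Real.rpow_mul (by norm_num), one_div_mul_cancel hε.ne', Real.rpow_one] at this
  linarith

end BinaryFormula

/-! ### Binary gates of state trees -/

namespace QTree

variable {n : ℕ} {S S' : Finset (Fin n)}

/-- The binary sum gate. -/
def binaryPlus (c c' : ℂ) (T T' : QTree n S) : QTree n S :=
  plus 2 (by norm_num) ![c, c'] ![T, T']

/-- The binary tensor gate. -/
def binaryTensor (T : QTree n S) (T' : QTree n S') (h : Disjoint S S') : QTree n (S ∪ S') :=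
  tensor 2 (by norm_num) ![S, S']
    (fun j l hjl => by fin_cases j <;> fin_cases l <;> simp_all [h.symm])
    (by ext; simp)
    (fun j => match j with
      | 0 => T
      | 1 => T')

theorem state_binaryPlus (c c' : ℂ) (T T' : QTree n S) :
    (binaryPlus c c' T T').state = c • T.state + c' • T'.state := by
  simp [binaryPlus, state, Fin.sum_univ_two]

theorem state_binaryTensor (T : QTree n S) (T' : QTree n S') (h : Disjoint S S')
    (y : (S ∪ S' : Finset (Fin n)) → Fin 2) :
    (binaryTensor T T' h).state y =
      T.state (fun i => y ⟨i.1, Finset.mem_union_left _ i.2⟩) *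
        T'.state (fun i => y ⟨i.1, Finset.mem_union_right _ i.2⟩) := by
  simp only [binaryTensor, state, Fin.prod_univ_two]
  rfl

theorem norm_state_binaryTensor (T : QTree n S) (T' : QTree n S') (h : Disjoint S S') :
    ‖(binaryTensor T T' h).state‖ = ‖T.state‖ * ‖T'.state‖ := by
  rw [EuclideanSpace.norm_eq, EuclideanSpace.norm_eq, EuclideanSpace.norm_eq,
    ← Real.sqrt_mul (by positivity)]
  congr 1
  simp only [state_binaryTensor, norm_mul, mul_pow]
  rw [Finset.sum_mul_sum, ← Fintype.sum_prod_type'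
    (f := fun (u : S → Fin 2) (v : S' → Fin 2) => ‖T.state u‖ ^ 2 * ‖T'.state v‖ ^ 2)]
  -- Assignments on a disjoint union are pairs of assignments.
  exact Fintype.sum_equiv ((Equiv.arrowCongr (Equiv.Finset.union S S' h).symm (Equiv.refl _)).trans
    (Equiv.sumArrowEquivProdArrow S S' (Fin 2))) _ _ fun y => rfl

theorem size_binaryPlus (c c' : ℂ) (T T' : QTree n S) :
    (binaryPlus c c' T T').size = T.size + T'.size := by
  simp [binaryPlus, size, Fin.sum_univ_two]

theorem size_binaryTensor (T : QTree n S) (T' : QTree n S') (h : Disjoint S S') :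
    (binaryTensor T T' h).size = T.size + T'.size := by
  simp only [binaryTensor, size, Fin.sum_univ_two]
  rfl

theorem depth_binaryPlus_le {c c' : ℂ} {T T' : QTree n S} {d d' : ℕ} (hT : T.depth ≤ d)
    (hT' : T'.depth ≤ d') : (binaryPlus c c' T T').depth ≤ max d d' + 1 := by
  simp only [binaryPlus, depth]
  refine Nat.succ_le_succ (Finset.sup_le fun j _ => ?_)
  fin_cases j
  · exact hT.trans (le_max_left _ _)
  · exact hT'.trans (le_max_right _ _)

theorem depth_binaryTensor_le {T : QTree n S} {T' : QTree n S'} {h : Disjoint S S'} {d d' : ℕ}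
    (hT : T.depth ≤ d) (hT' : T'.depth ≤ d') : (binaryTensor T T' h).depth ≤ max d d' + 1 := by
  simp only [binaryTensor, depth]
  refine Nat.succ_le_succ (Finset.sup_le fun j _ => ?_)
  fin_cases j
  · exact hT.trans (le_max_left _ _)
  · exact hT'.trans (le_max_right _ _)

theorem IsNormalized.norm_state {T : QTree n S} (h : T.IsNormalized) : ‖T.state‖ = 1 := by
  cases T with
  | leaf => exact h
  | plus => exact h.1
  | tensor => exact h.1

theorem IsNormalized.binaryPlus {c c' : ℂ} {T T' : QTree n S} (h : T.IsNormalized)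
    (h' : T'.IsNormalized) (hs : ‖c • T.state + c' • T'.state‖ = 1) :
    (binaryPlus c c' T T').IsNormalized := by
  refine ⟨(congrArg _ (state_binaryPlus c c' T T')).trans hs, fun j => ?_⟩
  fin_cases j
  · exact h
  · exact h'

theorem IsNormalized.binaryTensor {T : QTree n S} {T' : QTree n S'} (h : T.IsNormalized)
    (h' : T'.IsNormalized) (hd : Disjoint S S') : (binaryTensor T T' hd).IsNormalized := by
  refine ⟨(norm_state_binaryTensor T T' hd).trans ?_, fun j => ?_⟩
  · rw [h.norm_state, h'.norm_state, mul_one]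
  · fin_cases j
    · exact h
    · exact h'

theorem IsManifestlyOrthogonal.binaryPlus {c c' : ℂ} {T T' : QTree n S}
    (h : T.IsManifestlyOrthogonal) (h' : T'.IsManifestlyOrthogonal)
    (hs : ∀ y, T.state y = 0 ∨ T'.state y = 0) :
    (binaryPlus c c' T T').IsManifestlyOrthogonal := by
  refine ⟨fun j l hjl y => ?_, fun j => ?_⟩
  · fin_cases j <;> fin_cases l
    · exact absurd rfl hjl
    · exact hs y
    · exact (hs y).symm
    · exact absurd rfl hjl
  · fin_cases j
    · exact h
    · exact h'

theorem IsManifestlyOrthogonal.binaryTensor {T : QTree n S} {T' : QTree n S'}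
    (h : T.IsManifestlyOrthogonal) (h' : T'.IsManifestlyOrthogonal) (hd : Disjoint S S') :
    (binaryTensor T T' hd).IsManifestlyOrthogonal := by
  intro j
  fin_cases j
  · exact h
  · exact h'

/-- Every assignment of the bits in `S` extends to all bits. -/
theorem exists_restrict_eq (y : S → Fin 2) : ∃ x : Fin n → Fin 2, (fun i : S => x i.1) = y :=
  ⟨fun i => if h : i ∈ S then y ⟨i, h⟩ else 0, by funext i; simp⟩

end QTree

/-! ### Restoring normalization -/

namespace BinaryFormula

variable {n : ℕ} {o : Prop} {S : Finset (Fin n)} {s d : ℕ} {f : (Fin n → Fin 2) → ℂ}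

/-- A nonzero formula can be normalized at every vertex, up to a positive factor. -/
theorem exists_qTree (hf : BinaryFormula o S s d f) (h0 : ∃ x, f x ≠ 0) :
    ∃ T : QTree n S, T.IsNormalized ∧ (o → T.IsManifestlyOrthogonal) ∧ T.size ≤ s ∧
      T.depth ≤ d ∧ ∃ r : ℝ, 0 < r ∧ ∀ x, f x = r * T.state fun i => x i.1 := by
  induction hf with
  | leaf i α β =>
    set v : QubitSpace {i} :=
      WithLp.toLp 2 fun y : ({i} : Finset (Fin n)) → Fin 2 =>
        ![α, β] (y ⟨i, Finset.mem_singleton_self i⟩) with hv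
    have hne : v ≠ 0 := by
      obtain ⟨x, hx⟩ := h0
      intro h
      exact hx (congrFun (congrArg WithLp.ofLp h) fun j => x j.1)
    have hpos : 0 < ‖v‖ := norm_pos_iff.2 hne
    have hstate : (QTree.leaf i rfl ((‖v‖⁻¹ : ℝ) * α) ((‖v‖⁻¹ : ℝ) * β)).state =
        ((‖v‖⁻¹ : ℝ) : ℂ) • v := by
      ext y
      simp only [QTree.state, hv, PiLp.smul_apply, smul_eq_mul]
      generalize y ⟨i, _⟩ = b
      fin_cases b <;> simp
    refine ⟨QTree.leaf i rfl ((‖v‖⁻¹ : ℝ) * α) ((‖v‖⁻¹ : ℝ) * β), ?_, fun _ => trivial, le_rfl,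
      le_rfl, ‖v‖, hpos, fun x => ?_⟩
    · simp only [QTree.IsNormalized, hstate, norm_smul, Complex.norm_real, norm_inv, norm_norm]
      exact inv_mul_cancel₀ hpos.ne'
    · rw [hstate, PiLp.smul_apply, smul_eq_mul, ← mul_assoc, ← Complex.ofReal_mul,
        mul_inv_cancel₀ hpos.ne', Complex.ofReal_one, one_mul]
  | @add S s s' d d' f g hf hg h ihf ihg =>
    by_cases hf0 : ∃ x, f x ≠ 0
    swap
    -- A zero summand cannot be normalized, so the gate is replaced by its other input.
    · push Not at hf0
      simp only [hf0, zero_add] at h0 ⊢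
      obtain ⟨T, hn, ho, hs, hd, hr⟩ := ihg h0
      exact ⟨T, hn, ho, by omega, hd.trans (by omega), hr⟩
    by_cases hg0 : ∃ x, g x ≠ 0
    swap
    · push Not at hg0
      simp only [hg0, add_zero] at h0 ⊢
      obtain ⟨T, hn, ho, hs, hd, hr⟩ := ihf h0
      exact ⟨T, hn, ho, by omega, hd.trans (by omega), hr⟩
    obtain ⟨T, hn, ho, hs, hd, r, hr, hT⟩ := ihf hf0
    obtain ⟨T', hn', ho', hs', hd', r', hr', hT'⟩ := ihg hg0
    set v : QubitSpace S := (r : ℂ) • T.state + (r' : ℂ) • T'.state with hv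
    have hvx : ∀ x : Fin n → Fin 2, f x + g x = v fun i => x i.1 := fun x => by
      rw [hT, hT']; rfl
    have hne : v ≠ 0 := by
      obtain ⟨x, hx⟩ := h0
      intro h
      refine hx ((hvx x).trans ?_)
      rw [h]
      rfl
    have hpos : 0 < ‖v‖ := norm_pos_iff.2 hne
    have hstate : (((‖v‖⁻¹ : ℝ) : ℂ) * r) • T.state + (((‖v‖⁻¹ : ℝ) : ℂ) * r') • T'.state =
        ((‖v‖⁻¹ : ℝ) : ℂ) • v := by
      rw [hv, smul_add, smul_smul, smul_smul]
    refine ⟨QTree.binaryPlus (((‖v‖⁻¹ : ℝ) : ℂ) * r) (((‖v‖⁻¹ : ℝ) : ℂ) * r') T T',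
      hn.binaryPlus hn' ?_, fun h' => (ho h').binaryPlus (ho' h') fun y => ?_, ?_,
      QTree.depth_binaryPlus_le hd hd', ‖v‖, hpos, fun x => ?_⟩
    · rw [hstate, norm_smul, Complex.norm_real, norm_inv, norm_norm, inv_mul_cancel₀ hpos.ne']
    -- Rescaling by positive factors does not change supports.
    · obtain ⟨x, rfl⟩ := QTree.exists_restrict_eq y
      have := h h' x
      rw [hT, hT'] at this
      simpa [hr.ne', hr'.ne'] using this
    · rw [QTree.size_binaryPlus]; omega
    · rw [QTree.state_binaryPlus, hstate, PiLp.smul_apply, smul_eq_mul, ← mul_assoc,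
        ← Complex.ofReal_mul, mul_inv_cancel₀ hpos.ne', Complex.ofReal_one, one_mul]
      exact hvx x
  | @mul S S' s s' d d' f g hf hg h ihf ihg =>
    obtain ⟨x₀, hx₀⟩ := h0
    obtain ⟨T, hn, ho, hs, hd, r, hr, hT⟩ := ihf ⟨x₀, left_ne_zero_of_mul hx₀⟩
    obtain ⟨T', hn', ho', hs', hd', r', hr', hT'⟩ := ihg ⟨x₀, right_ne_zero_of_mul hx₀⟩
    refine ⟨QTree.binaryTensor T T' h, hn.binaryTensor hn' h,
      fun h' => (ho h').binaryTensor (ho' h') h, ?_, QTree.depth_binaryTensor_le hd hd', r * r',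
      mul_pos hr hr', fun x => ?_⟩
    · rw [QTree.size_binaryTensor]; omega
    · simp only [QTree.state_binaryTensor, hT, hT', Complex.ofReal_mul]
      ring

theorem exists_represents {ψ : EuclideanSpace ℂ (Fin n → Fin 2)} (hψ : ‖ψ‖ = 1)
    (hf : BinaryFormula o (Finset.univ : Finset (Fin n)) s d ψ.ofLp) :
    ∃ T : QTree n Finset.univ, T.Represents ψ ∧ (o → T.IsManifestlyOrthogonal) ∧
      T.size ≤ s ∧ T.depth ≤ d := by
  have h0 : ∃ x, ψ x ≠ 0 := by
    by_contra! h
    have : ψ = 0 := by ext x; exact h x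
    simp [this] at hψ
  obtain ⟨T, hn, ho, hs, hd, r, hr, hT⟩ := hf.exists_qTree h0
  refine ⟨T, ⟨hn, fun x => ?_⟩, ho, hs, hd⟩
  let e : (↥(Finset.univ : Finset (Fin n)) → Fin 2) ≃ (Fin n → Fin 2) :=
    Equiv.arrowCongr (Equiv.subtypeUnivEquiv Finset.mem_univ) (Equiv.refl _)
  -- Both norms are `1`, so the leftover positive factor `r` is `1`, with no phase to correct.
  have hnorm : ‖ψ‖ = r * ‖T.state‖ := by
    have hy : ∀ y, ‖T.state y‖ ^ 2 * r ^ 2 = ‖ψ (e y)‖ ^ 2 := by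
      intro y
      rw [hT, norm_mul, Complex.norm_real, Real.norm_of_nonneg hr.le, mul_pow, mul_comm]
      rfl
    rw [EuclideanSpace.norm_eq, ← Equiv.sum_comp e]
    simp only [← hy]
    rw [← Finset.sum_mul, Real.sqrt_mul (by positivity), Real.sqrt_sq hr.le,
      ← EuclideanSpace.norm_eq, mul_comm]
  rw [hψ, hn.norm_state, mul_one] at hnorm
  rw [hT, ← hnorm, Complex.ofReal_one, one_mul]

/-- Depth reduction for the least size of a tree representing `ψ`. -/
theorem exists_balanced {ε K : ℝ}
    (hK : ∀ (n : ℕ) (o : Prop) (S : Finset (Fin n)) (s d : ℕ) (f : (Fin n → Fin 2) → ℂ),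
      BinaryFormula o S s d f → Within o S ((s : ℝ) ^ (1 + ε)) (K * Real.log s) f)
    (o : Prop) (hn : 1 ≤ n) {ψ : EuclideanSpace ℂ (Fin n → Fin 2)} (hψ : ‖ψ‖ = 1) {m : ℕ}
    (hm : m = sInf {s | ∃ T : QTree n Finset.univ,
      T.Represents ψ ∧ (o → T.IsManifestlyOrthogonal) ∧ T.size = s}) :
    ∃ T : QTree n Finset.univ, T.Represents ψ ∧ (o → T.IsManifestlyOrthogonal) ∧
      (T.size : ℝ) ≤ max 1 K * (m : ℝ) ^ (1 + ε) ∧ (T.depth : ℝ) ≤ max 1 K * Real.log m := by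
  -- The minimum must be attained: `sInf ∅ = 0` would be a meaningless size. The expansion in basis
  -- states supplies a tree.
  have hmem := Nat.sInf_mem (s := {s | ∃ T : QTree n Finset.univ,
      T.Represents ψ ∧ (o → T.IsManifestlyOrthogonal) ∧ T.size = s}) (by
    obtain ⟨s, d, hf⟩ := exists_of_pos (o := o) hn ψ.ofLp
    obtain ⟨T, hT, ho, -⟩ := hf.exists_represents hψ
    exact ⟨T.size, T, hT, ho, rfl⟩)
  rw [← hm] at hmem
  obtain ⟨T, hT, ho, hs⟩ := hmem
  obtain ⟨d, hf⟩ := of_qTree T ho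
  rw [hs, show (fun x : Fin n → Fin 2 => T.state fun i => x i.1) = ψ.ofLp from funext hT.2] at hf
  obtain ⟨s', d', hf', hs', hd'⟩ := hK _ _ _ _ _ _ hf
  obtain ⟨T', hT', ho', hsize, hdepth⟩ := hf'.exists_represents hψ
  refine ⟨T', hT', ho', ?_, ?_⟩
  · calc (T'.size : ℝ) ≤ s' := by exact_mod_cast hsize
      _ ≤ 1 * (m : ℝ) ^ (1 + ε) := by rwa [one_mul]
      _ ≤ _ := by gcongr; exact le_max_left _ _
  · calc (T'.depth : ℝ) ≤ d' := by exact_mod_cast hdepth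
      _ ≤ K * Real.log m := hd'
      _ ≤ _ := mul_le_mul_of_nonneg_right (le_max_right _ _) (Real.log_natCast_nonneg m)

end BinaryFormula

theorem mainTheorem12 (ε : ℝ) (hε : 0 < ε) :
    ∃ C : ℝ, ∀ (n : ℕ), 1 ≤ n → ∀ ψ : EuclideanSpace ℂ (Fin n → Fin 2), ‖ψ‖ = 1 →
      (∃ T : QTree n Finset.univ, T.Represents ψ ∧
        (T.size : ℝ) ≤ C * (treeSize ψ : ℝ) ^ (1 + ε) ∧
        (T.depth : ℝ) ≤ C * Real.log (treeSize ψ)) ∧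
      (∃ T : QTree n Finset.univ, T.Represents ψ ∧ T.IsManifestlyOrthogonal ∧
        (T.size : ℝ) ≤ C * (manifestlyOrthogonalTreeSize ψ : ℝ) ^ (1 + ε) ∧
        (T.depth : ℝ) ≤ C * Real.log (manifestlyOrthogonalTreeSize ψ)) := by
  obtain ⟨K, hK⟩ := BinaryFormula.exists_within hε
  refine ⟨max 1 K, fun n hn ψ hψ => ⟨?_, ?_⟩⟩
  · obtain ⟨T, hT, -, h⟩ := BinaryFormula.exists_balanced hK False hn hψ (m := treeSize ψ)
      (by simp [treeSize])
    exact ⟨T, hT, h⟩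
  · obtain ⟨T, hT, ho, h⟩ := BinaryFormula.exists_balanced hK True hn hψ
      (m := manifestlyOrthogonalTreeSize ψ) (by simp [manifestlyOrthogonalTreeSize])
    exact ⟨T, hT, ho trivial, h⟩
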